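/- Let $k$ and $m$ be positive integers with $\gcd(k,m)=1$, and write $m=rp$ with $r$ a positive integer and $p$ a prime. Let $\mathbb F_{2^r}\subseteq\mathbb F_{2^m}$ be the finite fields with $2^r$ and $2^m$ elements, let $\beta\in\mathbb F_{2^r}$, and suppose that the polynomial $P(X)=X^{2^k+1}+X+\beta$ has no root in $\mathbb F_{2^r}$. (a) If $p\neq 3$, then $P(X)$ has no root in $\mathbb F_{2^m}$. (b) If $p=3$, then $P(X)$ has exactly three (distinct) roots in $\mathbb F_{2^m}$. -/

import Mathlib

open Polynomial

/-- The polynomial `P(X) = X^(2^k+1) + X + β` over a field `K`. -/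
noncomputable def trinomialP {K : Type*} [Field K] (k : ℕ) (β : K) : K[X] :=
  X ^ (2 ^ k + 1) + X + C β

/-! Write `q = 2^k` and let `σ` be the `q`-power map. Roots of `P` correspond to lines stable under
the semilinear map `w ↦ A σ(w)`, with `A = trinomialMatrix β`. Over `𝔽_{2^r}` its `r`-th iterate is
linear, with matrix the norm `N` of `A`. Since `N` is conjugate to `σ(N)`, its trace and determinant
are fixed by `σ`, hence lie in `𝔽₂`, and `det N = 1`. If the trace were `0`, then `(N - 1)² = 0` and
there would be a stable line: from Hilbert 90 if `N = 1`, the image of `N - 1` otherwise. So without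
a root `N² + N + 1 = 0` and `N³ = 1`. Over the cubic extension the norm is `N³ = 1`, and Hilbert 90
yields a root.

Conversely, Galois acts freely on the roots in `𝔽_{2^m}`, so `p` divides their number. One root thus
forces two, two force exactly three (`ncard_roots_eq_three`), and so `p = 3`. -/

open Matrix

/-! ### Norms along an endomorphism -/

section SemilinearIteration

variable {G : Type*} [Monoid G]

/-- The partial norms `a * S a * S (S a) * ⋯` (`n` factors) of `a` along the endomorphism `S`. -/
def partialNorm (S : G →* G) (a : G) : ℕ → G
  | 0 => 1
  | n + 1 => a * S (partialNorm S a n)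

theorem partialNorm_add (S : G →* G) (a : G) (n m : ℕ) :
    partialNorm S a (n + m) = partialNorm S a n * S^[n] (partialNorm S a m) := by
  induction n with
  | zero => simp [partialNorm]
  | succ n ih =>
    rw [Nat.succ_add, partialNorm, ih, map_mul, partialNorm, mul_assoc, Function.iterate_succ_apply']

/-- The norm with `n + 1` factors can lose its extra factor at either end. For invertible `a` this
makes `S N` conjugate to `N`. -/
theorem mul_map_partialNorm (S : G →* G) (a : G) (n : ℕ) (h : ∀ x, S^[n] x = x) :
    a * S (partialNorm S a n) = partialNorm S a n * a := by
  have h1 : partialNorm S a (n + 1) = a * S (partialNorm S a n) := rfl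
  rw [← h1, partialNorm_add, h]
  simp [partialNorm]

theorem partialNorm_mul (S : G →* G) (a : G) (n j : ℕ) (h : ∀ x, S^[n] x = x) :
    partialNorm S a (n * j) = partialNorm S a n ^ j := by
  induction j with
  | zero => simp [partialNorm]
  | succ j ih =>
    rw [Nat.mul_succ, add_comm, partialNorm_add, h, ih, pow_succ']

theorem map_partialNorm {H : Type*} [Monoid H] (S : G →* G) (T : H →* H) (f : G →* H)
    (h : ∀ x, f (S x) = T (f x)) (a : G) (n : ℕ) :
    f (partialNorm S a n) = partialNorm T (f a) n := by
  induction n with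
  | zero => simp [partialNorm]
  | succ n ih => simp [partialNorm, h, ih]

end SemilinearIteration

/-! ### Roots as stable lines of a semilinear map -/

section Roots

variable {E : Type*} [Field E]

theorem isRoot_trinomialP_iff (k : ℕ) (β x : E) :
    (trinomialP k β).IsRoot x ↔ x ^ (2 ^ k + 1) + x + β = 0 := by
  simp [trinomialP, IsRoot]

theorem map_trinomialP {F : Type*} [Field F] (f : E →+* F) (k : ℕ) (β : E) :
    (trinomialP k β).map f = trinomialP k (f β) := by
  simp [trinomialP]

/-- The matrix of the semilinear map whose fixed lines are the roots of `X ^ (q + 1) + X + β`. -/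
def trinomialMatrix (β : E) : Matrix (Fin 2) (Fin 2) E := !![0, 1; β⁻¹, β⁻¹]

/-- A ring homomorphism applied to the entries of a matrix of size two. -/
def entrywise {F : Type*} [Field F] (s : E →+* F) :
    Matrix (Fin 2) (Fin 2) E →* Matrix (Fin 2) (Fin 2) F :=
  (s.mapMatrix : Matrix (Fin 2) (Fin 2) E →+* Matrix (Fin 2) (Fin 2) F)

@[simp]
theorem entrywise_apply {F : Type*} [Field F] (s : E →+* F) (B : Matrix (Fin 2) (Fin 2) E)
    (i j : Fin 2) : entrywise s B i j = s (B i j) := rfl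

theorem det_trinomialMatrix (β : E) : (trinomialMatrix β).det = -β⁻¹ := by
  simp [trinomialMatrix, det_fin_two]

/-- Hilbert's Theorem 90 for a cyclic group acting on vectors of length two. -/
theorem exists_fixed_vector {s : E →+* E} {n : ℕ} (hn : 0 < n)
    (hs : Set.InjOn (fun i : ℕ => s ^ i) (Set.Iio n)) (hsn : s ^ n = 1)
    (A : Matrix (Fin 2) (Fin 2) E)
    (hA : partialNorm (entrywise s) A n = 1) :
    ∃ w : Fin 2 → E, w ≠ 0 ∧ A *ᵥ (s ∘ w) = w := by
  set c := partialNorm (entrywise s) A with hc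
  -- `g z i` is the `i`-th iterate of `w ↦ A s(w)` at `(z, 0)`. The map permutes these cyclically,
  -- so their sum over a period is fixed.
  let g : E → ℕ → Fin 2 → E := fun z i => c i *ᵥ ![(s ^ i) z, 0]
  have hg : ∀ z i, A *ᵥ (s ∘ g z i) = g z (i + 1) := by
    intro z i
    have h1 : s ∘ ![(s ^ i) z, 0] = ![(s ^ (i + 1)) z, 0] := by
      ext j; fin_cases j <;> simp [pow_succ']
    have h2 : s ∘ (c i *ᵥ ![(s ^ i) z, 0]) = (entrywise s (c i)) *ᵥ (s ∘ ![(s ^ i) z, 0]) := by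
      ext j; exact RingHom.map_mulVec s _ _ j
    simp only [g]
    rw [h2, mulVec_mulVec, h1]
    rfl
  have hfix : ∀ z, A *ᵥ (s ∘ ∑ i ∈ Finset.range n, g z i) = ∑ i ∈ Finset.range n, g z i := by
    intro z
    have h1 : s ∘ (∑ i ∈ Finset.range n, g z i) = ∑ i ∈ Finset.range n, s ∘ g z i := by
      ext j; simp
    have h3 : g z n = g z 0 := by
      simp only [g, hA, hsn]
      simp [hc, partialNorm]
    rw [h1, mulVec_sum]
    simp_rw [hg]
    have h4 := Finset.sum_range_succ (g z) n
    rw [Finset.sum_range_succ'] at h4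
    rw [h3] at h4
    exact add_right_cancel h4
  by_contra hcon
  push Not at hcon
  have hzero : ∀ z, ∑ i ∈ Finset.range n, g z i = 0 := by
    intro z
    by_contra h
    exact hcon _ h (hfix z)
  have hinj : Function.Injective (fun i : Fin n => ((s ^ (i : ℕ) : E →+* E) : E →* E)) := by
    intro i j hij
    apply Fin.ext
    apply hs i.2 j.2
    ext z
    exact DFunLike.congr_fun hij z
  -- If all these sums vanished, their first coordinates would be a relation between distinct
  -- characters in which the identity has coefficient `c 0 0 0 = 1`.
  have hli := (linearIndependent_monoidHom E E).comp _ hinj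
  rw [Fintype.linearIndependent_iff] at hli
  have := hli (fun i => c i 0 0) (by
    ext z
    have h := congrFun (hzero z) 0
    rw [Finset.sum_apply, Finset.sum_range] at h
    simpa [g, mulVec, dotProduct, Fin.sum_univ_two] using h) ⟨0, hn⟩
  simp [hc, partialNorm] at this

variable [CharP E 2]

/-- The root is the slope `w 0 / w 1`; the line `w 1 = 0` is never stable. -/
theorem exists_root_of_fixed_line {k : ℕ} {β : E} (hβ : β ≠ 0) {w : Fin 2 → E} (hw : w ≠ 0)
    (h : w 0 * (trinomialMatrix β *ᵥ (iterateFrobenius E 2 k ∘ w)) 1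
      = w 1 * (trinomialMatrix β *ᵥ (iterateFrobenius E 2 k ∘ w)) 0) :
    ∃ x, (trinomialP k β).IsRoot x := by
  have h2 : (2 : E) = 0 := CharTwo.two_eq_zero
  simp only [trinomialMatrix, mulVec, dotProduct, Fin.sum_univ_two, of_apply, cons_val_zero,
    cons_val_one, Function.comp, iterateFrobenius_def, zero_mul, one_mul, zero_add,
    cons_val', cons_val_fin_one] at h
  have hb : w 1 ≠ 0 := by
    intro hb
    rw [hb] at h
    have ha : w 0 = 0 := by
      by_contra ha
      simp [ha, hβ] at h
    exact hw (by ext i; fin_cases i <;> assumption)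
  refine ⟨w 0 / w 1, ?_⟩
  rw [isRoot_trinomialP_iff, pow_succ, div_pow]
  field_simp
  field_simp at h
  linear_combination h + (w 1 * w 1 ^ 2 ^ k * β) * h2

end Roots

/-! ### Counting roots and computing the norm over a finite field -/

section FiniteField

variable {E : Type*} [Field E] {k n : ℕ}

theorem pow_two_pow_of_card (hE : Nat.card E = 2 ^ n) (x : E) : x ^ 2 ^ n = x := by
  have : Finite E := Nat.finite_of_card_ne_zero (by rw [hE]; positivity)
  have := Fintype.ofFinite E
  rw [← hE, Nat.card_eq_fintype_card, FiniteField.pow_card]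

/-- As `2^k - 1` is coprime to `2^n - 1`, raising to that power is bijective on units. -/
theorem existsUnique_pow_two_pow_eq_mul (hE : Nat.card E = 2 ^ n) (hkn : k.Coprime n) {c : E}
    (hc : c ≠ 0) : ∃! y : E, y ≠ 0 ∧ y ^ 2 ^ k = c * y := by
  have : Finite E := Nat.finite_of_card_ne_zero (by rw [hE]; positivity)
  have hcop : (Nat.card Eˣ).Coprime (2 ^ k - 1) := by
    rw [Nat.card_units, hE, Nat.Coprime, Nat.pow_sub_one_gcd_pow_sub_one, hkn.symm.gcd_eq_one]
    rfl
  have hk1 : 2 ^ k = (2 ^ k - 1) + 1 := (Nat.sub_add_cancel Nat.one_le_two_pow).symm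
  have hbij := (powCoprime hcop).bijective
  obtain ⟨u, hu⟩ := hbij.2 (Units.mk0 c hc)
  have hu' : (u : E) ^ (2 ^ k - 1) = c := by
    have := congrArg Units.val hu
    simpa using this
  refine ⟨u, ⟨u.ne_zero, ?_⟩, ?_⟩
  · rw [hk1, pow_succ, hu']
  · rintro y ⟨hy, hyc⟩
    rw [hk1, pow_succ] at hyc
    have h := mul_right_cancel₀ hy hyc
    have h2 : powCoprime hcop (Units.mk0 y hy) = powCoprime hcop u := by
      rw [hu]
      ext
      simpa using h
    have h3 := hbij.1 h2
    rw [← h3]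
    rfl

/-- Periods `k` and `n` under squaring combine to period `gcd(k, n) = 1`. -/
theorem eq_zero_or_one_of_pow_eq_self (hE : Nat.card E = 2 ^ n) (hkn : k.Coprime n) {x : E}
    (hx : x ^ 2 ^ k = x) : x = 0 ∨ x = 1 := by
  have h1 : Function.IsPeriodicPt (fun y : E => y ^ 2) k x := by
    rw [Function.IsPeriodicPt, Function.IsFixedPt, pow_iterate]; exact hx
  have h2 : Function.IsPeriodicPt (fun y : E => y ^ 2) n x := by
    rw [Function.IsPeriodicPt, Function.IsFixedPt, pow_iterate]; exact pow_two_pow_of_card hE x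
  have h3 := h1.gcd h2
  rw [hkn.gcd_eq_one] at h3
  have h4 : x ^ 2 = x := h3
  have h5 : x * (x - 1) = 0 := by linear_combination h4
  rcases mul_eq_zero.1 h5 with h | h
  · exact Or.inl h
  · exact Or.inr (sub_eq_zero.1 h)

variable [CharP E 2]

theorem iterateFrobenius_pow_apply (i : ℕ) (x : E) :
    (iterateFrobenius E 2 k ^ i) x = x ^ 2 ^ (k * i) := by
  rw [iterateFrobenius_eq_pow, ← pow_mul, ← iterateFrobenius_eq_pow, iterateFrobenius_def]

theorem iterateFrobenius_pow_card (hE : Nat.card E = 2 ^ n) : iterateFrobenius E 2 k ^ n = 1 := by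
  ext x
  rw [iterateFrobenius_eq_pow, ← pow_mul, mul_comm, pow_mul, ← iterateFrobenius_eq_pow]
  have : iterateFrobenius E 2 n = 1 := by
    ext y
    rw [iterateFrobenius_def, pow_two_pow_of_card hE, RingHom.one_def, RingHom.id_apply]
  rw [this, one_pow]

theorem injOn_iterateFrobenius_pow (hE : Nat.card E = 2 ^ n) (hkn : k.Coprime n) :
    Set.InjOn (fun i : ℕ => iterateFrobenius E 2 k ^ i) (Set.Iio n) := by
  have : Finite E := Nat.finite_of_card_ne_zero (by rw [hE]; positivity)
  have := Fintype.ofFinite E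
  let _ : Algebra (ZMod 2) E := ZMod.algebra E 2
  have hfr : Module.finrank (ZMod 2) E = n := by
    have h := Module.natCard_eq_pow_finrank (K := ZMod 2) (V := E)
    rw [hE, Nat.card_zmod] at h
    exact (Nat.pow_right_injective le_rfl h).symm
  have ho := FiniteField.orderOf_frobeniusAlgEquivOfAlgebraic (ZMod 2) E
  rw [hfr] at ho
  have hok : orderOf (FiniteField.frobeniusAlgEquivOfAlgebraic (ZMod 2) E ^ k) = n := by
    rw [Nat.Coprime.orderOf_pow (by rw [ho]; exact hkn.symm), ho]
  have happ : ∀ i x, ((FiniteField.frobeniusAlgEquivOfAlgebraic (ZMod 2) E ^ k) ^ i) x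
      = x ^ 2 ^ (k * i) := by
    intro i x
    rw [← pow_mul, AlgEquiv.coe_pow, FiniteField.coe_frobeniusAlgEquivOfAlgebraic_iterate,
      ZMod.card]
  intro i hi j hj hij
  refine pow_injOn_Iio_orderOf (by rwa [hok]) (by rwa [hok]) ?_
  ext x
  simp only [happ]
  rw [← iterateFrobenius_pow_apply, ← iterateFrobenius_pow_apply]
  exact DFunLike.congr_fun hij x

/-- A root `t` satisfies `t^q = 1 + β/t`, so for any further root `x` the ratio `y = (x - x₁)/(x -
x₂)` satisfies `y^q = (x₂/x₁) y`. This has exactly one nonzero solution, and solving for `x` gives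
the third root. -/
theorem ncard_roots_eq_three (hE : Nat.card E = 2 ^ n) (hkn : k.Coprime n) {β x₁ x₂ : E}
    (hβ : β ≠ 0) (h₁ : (trinomialP k β).IsRoot x₁) (h₂ : (trinomialP k β).IsRoot x₂)
    (hne : x₁ ≠ x₂) : {x : E | (trinomialP k β).IsRoot x}.ncard = 3 := by
  have root_iff : ∀ x : E, (trinomialP k β).IsRoot x ↔ x * x ^ 2 ^ k = x + β := by
    intro x
    have h2 : (2 : E) = 0 := CharTwo.two_eq_zero
    rw [isRoot_trinomialP_iff, pow_succ]
    constructor <;> intro h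
    · linear_combination h - (x + β) * h2
    · linear_combination h + (x + β) * h2
  have root_ne : ∀ x : E, (trinomialP k β).IsRoot x → x ≠ 0 := by
    rintro x hx rfl
    rw [root_iff] at hx
    simp at hx
    exact hβ hx.symm
  have z₁ := root_ne _ h₁
  have z₂ := root_ne _ h₂
  obtain ⟨y, ⟨hy, hyc⟩, huniq⟩ := existsUnique_pow_two_pow_eq_mul hE hkn (div_ne_zero z₂ z₁)
  have hy1 : 1 - y ≠ 0 := by
    intro h
    have : y = 1 := (sub_eq_zero.1 h).symm
    rw [this] at hyc
    simp at hyc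
    field_simp at hyc
    exact hne hyc
  have hq : ∀ a b : E, (a - b) ^ 2 ^ k = a ^ 2 ^ k - b ^ 2 ^ k := fun a b => sub_pow_char_pow a b k
  have hnum : x₁ - y * x₂ ≠ 0 := by
    intro h
    have h1 : y ^ 2 ^ k = 1 := by
      rw [hyc]; field_simp; linear_combination -h
    have h2 : (1 - y) ^ 2 ^ k = 0 := by rw [hq, h1]; simp
    exact hy1 (pow_eq_zero_iff (by positivity) |>.1 h2)
  have hset : {x : E | (trinomialP k β).IsRoot x} = {x₁, x₂, (x₁ - y * x₂) / (1 - y)} := by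
    have e₁ := (root_iff _).1 h₁
    have e₂ := (root_iff _).1 h₂
    ext x
    simp only [Set.mem_ofPred_eq, Set.mem_insert_iff, Set.mem_singleton_iff]
    constructor
    · intro hx
      have z := root_ne _ hx
      have e := (root_iff _).1 hx
      by_cases hx1 : x = x₁
      · exact Or.inl hx1
      by_cases hx2 : x = x₂
      · exact Or.inr (Or.inl hx2)
      have d1 : x - x₁ ≠ 0 := sub_ne_zero.2 hx1
      have d2 : x - x₂ ≠ 0 := sub_ne_zero.2 hx2
      have hxy : (x - x₁) / (x - x₂) = y := by
        refine huniq _ ⟨div_ne_zero d1 d2, ?_⟩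
        have f : ∀ t, t ≠ 0 → t * t ^ 2 ^ k = t + β → t ^ 2 ^ k = (t + β) / t := by
          intro t ht h
          field_simp
          linear_combination h
        have d2' : x ^ 2 ^ k - x₂ ^ 2 ^ k ≠ 0 := by
          rw [← hq]; exact pow_ne_zero _ d2
        rw [div_pow, hq, hq, div_eq_iff d2', f _ z e, f _ z₁ e₁, f _ z₂ e₂]
        field_simp
        ring
      right; right
      rw [← hxy] at hy1 ⊢
      rw [eq_div_iff hy1]
      field_simp
      ring
    · rintro (rfl | rfl | rfl)
      · exact h₁
      · exact h₂
      · have hq1 : (1 - y) ^ 2 ^ k = 1 - x₂ / x₁ * y := by rw [hq, hyc, one_pow]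
        have hq1' : 1 - x₂ / x₁ * y ≠ 0 := hq1 ▸ pow_ne_zero _ hy1
        rw [root_iff, div_pow, hq, mul_pow, hq1, hyc]
        rw [← mul_div_assoc, div_eq_iff hq1']
        have e₁' : x₁ ^ 2 ^ k = (x₁ + β) / x₁ := by field_simp; linear_combination e₁
        have e₂' : x₂ ^ 2 ^ k = (x₂ + β) / x₂ := by field_simp; linear_combination e₂
        rw [e₁', e₂']
        field_simp
        ring
  have hne1 : x₁ ≠ (x₁ - y * x₂) / (1 - y) := by
    intro h
    rw [eq_div_iff hy1] at h
    exact mul_ne_zero hy (sub_ne_zero.2 hne) (by linear_combination -h)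
  have hne2 : x₂ ≠ (x₁ - y * x₂) / (1 - y) := by
    intro h
    rw [eq_div_iff hy1] at h
    exact hne (by linear_combination -h)
  rw [hset, Set.ncard_eq_three]
  exact ⟨_, _, _, hne, hne1, hne2, rfl⟩

theorem iterate_mapMatrix_iterateFrobenius (hE : Nat.card E = 2 ^ n)
    (B : Matrix (Fin 2) (Fin 2) E) :
    (entrywise (iterateFrobenius E 2 k))^[n] B = B := by
  have key : ∀ i, (entrywise (iterateFrobenius E 2 k))^[i] B
      = entrywise (iterateFrobenius E 2 k ^ i) B := by
    intro i
    induction i with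
    | zero => ext; simp
    | succ i ih => rw [Function.iterate_succ_apply', ih, pow_succ']; ext; simp
  rw [key, iterateFrobenius_pow_card hE]
  ext; simp

theorem exists_root_of_partialNorm_eq_one (hE : Nat.card E = 2 ^ n) (hn : 0 < n)
    (hkn : k.Coprime n) {β : E} (hβ : β ≠ 0)
    (h : partialNorm (entrywise (iterateFrobenius E 2 k))
      (trinomialMatrix β) n = 1) :
    ∃ x, (trinomialP k β).IsRoot x := by
  obtain ⟨w, hw, hfix⟩ := exists_fixed_vector hn (injOn_iterateFrobenius_pow hE hkn)
    (iterateFrobenius_pow_card hE) _ h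
  exact exists_root_of_fixed_line hβ hw (by rw [hfix, mul_comm])

theorem partialNorm_pow_three_of_no_root (hE : Nat.card E = 2 ^ n) (hn : 0 < n)
    (hkn : k.Coprime n) {β : E} (hβ : β ≠ 0) (hroot : ∀ x, ¬ (trinomialP k β).IsRoot x) :
    partialNorm (entrywise (iterateFrobenius E 2 k))
      (trinomialMatrix β) n ^ 3 = 1 := by
  set S : Matrix (Fin 2) (Fin 2) E →* Matrix (Fin 2) (Fin 2) E :=
    entrywise (iterateFrobenius E 2 k)
  set A := trinomialMatrix β with hAdef
  set N := partialNorm S A n with hN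
  have h2 : (2 : E) = 0 := CharTwo.two_eq_zero
  have hcomm : A * S N = N * A :=
    mul_map_partialNorm S A n (iterate_mapMatrix_iterateFrobenius hE)
  have hAdet : A.det ≠ 0 := by rw [hAdef, det_trinomialMatrix]; simpa using hβ
  have hAu : IsUnit A.det := hAdet.isUnit
  have hdetS : (S N).det = N.det ^ 2 ^ k := by
    rw [← iterateFrobenius_def, RingHom.map_det]; rfl
  have htrS : (S N).trace = N.trace ^ 2 ^ k := by
    rw [← iterateFrobenius_def, AddMonoidHom.map_trace]; rfl
  have hdetfix : N.det ^ 2 ^ k = N.det := by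
    have h := congrArg det hcomm
    rw [det_mul, det_mul, hdetS, mul_comm N.det] at h
    exact mul_left_cancel₀ hAdet h
  have htrfix : N.trace ^ 2 ^ k = N.trace := by
    have h1 : S N = A⁻¹ * (N * A) := by rw [← hcomm, nonsing_inv_mul_cancel_left _ _ hAu]
    rw [← htrS, h1, trace_mul_comm, mul_assoc, mul_nonsing_inv _ hAu, mul_one]
  have hdetne : N.det ≠ 0 := by
    have : ∀ i, (partialNorm S A i).det ≠ 0 := by
      intro i
      induction i with
      | zero => simp [partialNorm]
      | succ i ih =>
        have : (S (partialNorm S A i)).det = (partialNorm S A i).det ^ 2 ^ k := by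
          rw [← iterateFrobenius_def, RingHom.map_det]; rfl
        rw [partialNorm, det_mul, this]
        exact mul_ne_zero hAdet (pow_ne_zero _ ih)
    exact this n
  have hdet : N.det = 1 := (eq_zero_or_one_of_pow_eq_self hE hkn hdetfix).resolve_left hdetne
  have hCH : N * N = N.trace • N - 1 := by
    rw [det_fin_two] at hdet
    ext i j
    fin_cases i <;> fin_cases j <;>
      simp [mul_apply, Fin.sum_univ_two, trace_fin_two] <;>
      first | ring1 | linear_combination -hdet
  have htwo : (2 : Matrix (Fin 2) (Fin 2) E) = 0 := by
    ext i j; fin_cases i <;> fin_cases j <;> simp [ofNat_apply, h2]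
  rcases eq_zero_or_one_of_pow_eq_self hE hkn htrfix with htr | htr
  -- Trace `0` makes `N` unipotent, and either case below produces a root.
  · exfalso
    rw [htr, zero_smul, zero_sub] at hCH
    have hsq : N * N = 1 := by
      rw [hCH, neg_eq_iff_add_eq_zero, one_add_one_eq_two, htwo]
    by_cases hN1 : N = 1
    · obtain ⟨x, hx⟩ := exists_root_of_partialNorm_eq_one hE hn hkn hβ hN1
      exact hroot x hx
    obtain ⟨v, hv⟩ : ∃ v, (N - 1) *ᵥ v ≠ 0 := by
      by_contra hcon
      push Not at hcon
      refine hN1 (sub_eq_zero.1 (Matrix.mulVec_injective ?_))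
      funext v
      rw [hcon, zero_mulVec]
    set w := (N - 1) *ᵥ v
    have hw : (N - 1) *ᵥ w = 0 := by
      have : (N - 1) * (N - 1) = 0 := by
        have : (N - 1) * (N - 1) = N * N + 1 - 2 * N := by noncomm_ring
        rw [this, hsq, htwo, one_add_one_eq_two, htwo]; simp
      rw [mulVec_mulVec, this, zero_mulVec]
    set u := A *ᵥ (iterateFrobenius E 2 k ∘ w) with hu
    have huker : (N - 1) *ᵥ u = 0 := by
      have h3 : (N - 1) * A = A * S (N - 1) := by
        have : S (N - 1) = S N - 1 := by
          have h := map_sub ((iterateFrobenius E 2 k).mapMatrix :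
            Matrix (Fin 2) (Fin 2) E →+* Matrix (Fin 2) (Fin 2) E) N 1
          rwa [map_one] at h
        rw [this, sub_mul, mul_sub, hcomm, one_mul, mul_one]
      have h4 : S (N - 1) *ᵥ (iterateFrobenius E 2 k ∘ w)
          = iterateFrobenius E 2 k ∘ ((N - 1) *ᵥ w) := by
        ext j
        rw [Function.comp_apply, RingHom.map_mulVec]; rfl
      rw [hu, mulVec_mulVec, h3, ← mulVec_mulVec, h4, hw]
      have : (iterateFrobenius E 2 k ∘ (0 : Fin 2 → E)) = 0 := by ext; simp
      rw [this, mulVec_zero]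
    -- Both `w` and its image `u` are killed by `N - 1`; were they independent, `N` would be `1`.
    have hdetW : w 0 * u 1 = w 1 * u 0 := by
      by_contra hcon
      have hprod : (N - 1) * !![w 0, u 0; w 1, u 1] = 0 := by
        ext i j
        have hwi := congrFun hw i
        have hui := congrFun huker i
        simp only [mulVec, dotProduct, Fin.sum_univ_two, Pi.zero_apply] at hwi hui
        fin_cases j
        · simpa [mul_apply, Fin.sum_univ_two] using hwi
        · simpa [mul_apply, Fin.sum_univ_two] using hui
      have hunit : IsUnit (!![w 0, u 0; w 1, u 1] : Matrix (Fin 2) (Fin 2) E).det := by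
        rw [det_fin_two_of, isUnit_iff_ne_zero, sub_ne_zero]
        intro h
        exact hcon (by rw [h, mul_comm])
      have := congrArg (· * (!![w 0, u 0; w 1, u 1] : Matrix (Fin 2) (Fin 2) E)⁻¹) hprod
      simp only [mul_assoc, mul_nonsing_inv _ hunit, mul_one, zero_mul] at this
      exact hN1 (sub_eq_zero.1 this)
    obtain ⟨x, hx⟩ := exists_root_of_fixed_line hβ hv hdetW
    exact hroot x hx
  · rw [htr, one_smul] at hCH
    have : N ^ 3 = N * (N * N) := by rw [pow_succ', pow_two]
    rw [this, hCH, mul_sub, hCH, mul_one, sub_sub, add_comm, ← sub_sub, sub_self, zero_sub,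
      neg_eq_iff_add_eq_zero, one_add_one_eq_two, htwo]

end FiniteField

/-! ### Passing to the extension field -/

section Extension

variable {K L : Type*} [Field K] [Field L] [Algebra K L]

theorem mem_range_algebraMap_of_pow_eq_self {r : ℕ} (hK : Nat.card K = 2 ^ r)
    {x : L} (hx : x ^ 2 ^ r = x) : x ∈ Set.range (algebraMap K L) := by
  have : Finite K := Nat.finite_of_card_ne_zero (by rw [hK]; positivity)
  have hne : (X ^ Nat.card K - X : K[X]) ≠ 0 :=
    FiniteField.X_pow_card_sub_X_ne_zero K Finite.one_lt_card
  refine splits_X_pow_nat_card_sub_X.mem_range_of_isRoot hne (i := algebraMap K L) ?_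
  rw [hK, IsRoot, eval_map]
  simp [hx]

/-- If `P` has no roots in `K`, the Galois group of prime order `p` acts freely on its roots. -/
theorem prime_dvd_ncard_roots {k r p : ℕ} (hp : p.Prime) [CharP K 2] [CharP L 2]
    (hK : Nat.card K = 2 ^ r) (hL : Nat.card L = 2 ^ (r * p)) {β : K}
    (hβ : ∀ x : K, ¬ (trinomialP k β).IsRoot x) :
    p ∣ {x : L | (trinomialP k (algebraMap K L β)).IsRoot x}.ncard := by
  classical
  have : Finite L := Nat.finite_of_card_ne_zero (by rw [hL]; positivity)
  have := Fact.mk hp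
  set R := {x : L | (trinomialP k (algebraMap K L β)).IsRoot x}
  have := Fintype.ofFinite R
  have hmaps : ∀ x ∈ R, x ^ 2 ^ r ∈ R := by
    intro x hx
    have hx' := (isRoot_trinomialP_iff k _ x).1 hx
    refine (isRoot_trinomialP_iff k _ _).2 ?_
    have h := congrArg (iterateFrobenius L 2 r) hx'
    simp only [map_add, map_pow, map_zero, iterateFrobenius_def] at h
    rwa [← map_pow, pow_two_pow_of_card hK] at h
  let f : Function.End R := fun x => ⟨x.1 ^ 2 ^ r, hmaps x.1 x.2⟩
  have hf : ∀ i x, ((f ^ i) x).1 = x.1 ^ 2 ^ (r * i) := by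
    intro i
    induction i with
    | zero => intro x; rw [Nat.mul_zero, pow_zero, pow_zero, pow_one]; rfl
    | succ i ih =>
      intro x
      rw [pow_succ]
      show ((f ^ i) (f x)).1 = _
      rw [ih, ← pow_mul, ← pow_add, Nat.mul_succ, add_comm]
  -- The exponent `p ^ 1` matches the fixed-point congruence modulo `p`, which concerns maps of
  -- `p`-power order.
  have hfp : f ^ p ^ 1 = 1 := by
    funext x
    apply Subtype.ext
    rw [pow_one, hf, pow_two_pow_of_card hL]
    rfl
  have hmod := Equiv.Perm.card_fixedPoints_modEq hfp
  have hempty : IsEmpty (Function.fixedPoints f) := by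
    constructor
    rintro ⟨x, hx⟩
    have hx' : x.1 ^ 2 ^ r = x.1 := congrArg Subtype.val hx
    obtain ⟨a, ha⟩ := mem_range_algebraMap_of_pow_eq_self hK hx'
    have hxR := x.2
    simp only [R, Set.mem_ofPred_eq, ← ha, ← map_trinomialP] at hxR
    exact hβ a (hxR.of_map (algebraMap K L).injective)
  rw [Fintype.card_eq_zero (α := Function.fixedPoints f)] at hmod
  rw [← Nat.card_coe_set_eq, Nat.card_eq_fintype_card]
  exact (Nat.modEq_zero_iff_dvd).1 hmod

/-- The norm of `A` with `3r` factors is the cube of the one over `K`, hence `1`, so Hilbert 90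
applies over `L`. -/
theorem exists_root_of_degree_three {k r : ℕ} (hr : 0 < r) (hkr : k.Coprime (r * 3)) [CharP K 2]
    [CharP L 2] (hK : Nat.card K = 2 ^ r) (hL : Nat.card L = 2 ^ (r * 3)) {β : K} (hβ0 : β ≠ 0)
    (hβ : ∀ x : K, ¬ (trinomialP k β).IsRoot x) :
    ∃ x : L, (trinomialP k (algebraMap K L β)).IsRoot x := by
  refine exists_root_of_partialNorm_eq_one hL (by omega) hkr (by simpa using hβ0) ?_
  have hA : entrywise (algebraMap K L) (trinomialMatrix β)
      = trinomialMatrix (algebraMap K L β) := by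
    ext i j
    fin_cases i <;> fin_cases j <;> simp [trinomialMatrix]
  rw [← hA, ← map_partialNorm (entrywise (iterateFrobenius K 2 k)), partialNorm_mul _ _ _ _
    (iterate_mapMatrix_iterateFrobenius hK), partialNorm_pow_three_of_no_root hK hr
    (hkr.coprime_dvd_right (dvd_mul_right r 3)) hβ0 hβ, map_one]
  intro B
  ext i j
  simp [iterateFrobenius_def]

end Extension

theorem mainTheorem9 {K L : Type*} [Field K] [Field L] [Algebra K L]
    (k m r p : ℕ) (hk : 0 < k) (hm : 0 < m) (hkm : Nat.gcd k m = 1)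
    (hp : p.Prime) (hmrp : m = r * p)
    (hK : Nat.card K = 2 ^ r) (hL : Nat.card L = 2 ^ m)
    (β : K) (hβ : ∀ x : K, ¬ (trinomialP k β).IsRoot x) :
    (p ≠ 3 → ∀ x : L, ¬ ((trinomialP k β).map (algebraMap K L)).IsRoot x) ∧
    (p = 3 → {x : L | ((trinomialP k β).map (algebraMap K L)).IsRoot x}.ncard = 3) := by
  have hr : 0 < r := Nat.pos_of_mul_pos_right (hmrp ▸ hm)
  have : Finite K := Nat.finite_of_card_ne_zero (by rw [hK]; positivity)
  have : Finite L := Nat.finite_of_card_ne_zero (by rw [hL]; positivity)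
  have := Fintype.ofFinite K
  have : CharP K 2 := charP_of_card_eq_prime_pow (by rw [← Nat.card_eq_fintype_card, hK])
  have : CharP L 2 := charP_of_injective_algebraMap (algebraMap K L).injective 2
  have hβ0 : β ≠ 0 := by
    rintro rfl
    exact hβ 0 ((isRoot_trinomialP_iff k _ _).2 (by simp))
  have hβL : algebraMap K L β ≠ 0 := by simpa using hβ0
  rw [map_trinomialP]
  have hdvd := prime_dvd_ncard_roots (L := L) hp hK (hmrp ▸ hL) hβ
  have hthree : ∀ x : L, (trinomialP k (algebraMap K L β)).IsRoot x →
      p = 3 ∧ {x : L | (trinomialP k (algebraMap K L β)).IsRoot x}.ncard = 3 := by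
    intro x hx
    set R := {x : L | (trinomialP k (algebraMap K L β)).IsRoot x}
    have hpos : 0 < R.ncard := (Set.ncard_pos (Set.toFinite _)).2 ⟨x, hx⟩
    -- A nonzero multiple of `p` is at least `2`, so a second root comes for free.
    have hlt : 1 < R.ncard := hp.one_lt.trans_le (Nat.le_of_dvd hpos hdvd)
    obtain ⟨a, ha, b, hb, hab⟩ := (Set.one_lt_ncard (Set.toFinite _)).1 hlt
    have hR : R.ncard = 3 := ncard_roots_eq_three hL hkm hβL ha hb hab
    exact ⟨(Nat.prime_dvd_prime_iff_eq hp Nat.prime_three).1 (hR ▸ hdvd), hR⟩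
  refine ⟨fun h x hx => h (hthree x hx).1, fun h => ?_⟩
  subst h
  obtain ⟨x, hx⟩ := exists_root_of_degree_three (L := L) hr (hmrp ▸ hkm) hK (hmrp ▸ hL) hβ0 hβ
  exact (hthree x hx).2
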